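/- Let $m,n$ be positive integers. For a real tensor $\mathcal{A}=(a_{i_1i_2\cdots i_m})_{1\le i_1,\dots,i_m\le n}$ of order $m$ and dimension $n$ and $x\in\mathbb{R}^n$, let $\mathcal{A}x^{m-1}\in\mathbb{R}^n$ be the vector with coordinates $$(\mathcal{A}x^{m-1})_i=\sum_{i_2,\dots,i_m=1}^n a_{ii_2\cdots i_m}x_{i_2}\cdots x_{i_m},\qquad 1\le i\le n .$$ Let $X\subseteq\mathbb{R}^n$ be a nonempty closed convex set with $0\in X$. (1) Suppose that $\mathcal{A}$ is strictly positive definite on $X$, that is, $(x-y)^\top(\mathcal{A}x^{m-1}-\mathcal{A}y^{m-1})>0$ for all $x,y\in X$ with $x\ne y$. Then for every $q\in\mathbb{R}^n$ the tensor variational inequality $\mathrm{TVI}(X,\mathcal{A},q)$ has exactly one solution, that is, there is exactly one $x^*\in X$ such that $$\langle y-x^*,\ \mathcal{A}(x^*)^{m-1}+q\rangle\ge 0\qquad\text{for all } y\in X .$$ (2) Equivalently, suppose that for some $p\in\mathbb{R}^n$ the function $x\mapsto\mathcal{A}x^{m-1}+p$ is strictly monotone on $X$, where $F$ is strictly monotone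 on $X$ if $\langle F(x)-F(y),x-y\rangle>0$ for all $x,y\in X$ with $x\neq y$. Then for every $q\in\mathbb{R}^n$, with $F(x)=\mathcal{A}x^{m-1}+q$, the variational inequality $\mathrm{VI}(X,F)$ has exactly one solution, that is, there is exactly one $x^*\in X$ such that $\langle y-x^*,F(x^*)\rangle\ge 0$ for all $y\in X$. -/

import Mathlib

/-- Real tensors of order `m` and dimension `n`: arrays `a_{i₁ i₂ ⋯ iₘ}` with every index
in an `n`-element set. -/
abbrev RealTensor (m n : ℕ) : Type := (Fin m → Fin n) → ℝ

/-- The vector `𝒜 x^{m-1}`. Its `i`-th coordinate is the sum of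
`a_{i i₂ ⋯ iₘ} x_{i₂} ⋯ x_{iₘ}` over `i₂, …, iₘ`, that is, over all multi-indices `j`
whose first entry is `i`; the product runs over the entries of `j` other than the first. -/
noncomputable def RealTensor.applyPow {m n : ℕ} [NeZero m] (A : RealTensor m n)
    (x : EuclideanSpace ℝ (Fin n)) : EuclideanSpace ℝ (Fin n) :=
  WithLp.toLp 2 fun i =>
    ∑ j : Fin m → Fin n with j 0 = i, A j * ∏ k ∈ Finset.univ.erase (0 : Fin m), x (j k)

/-- `𝒜` is strictly positive definite on `X`. -/
def RealTensor.StrictlyPosDefOn {m n : ℕ} [NeZero m] (A : RealTensor m n)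
    (X : Set (EuclideanSpace ℝ (Fin n))) : Prop :=
  ∀ x ∈ X, ∀ y ∈ X, x ≠ y → 0 < inner ℝ (x - y) (A.applyPow x - A.applyPow y)

/-- `F` is strictly monotone on `X` (only the values of `F` on `X` matter). -/
def StrictlyMonotoneOn {n : ℕ} (F : EuclideanSpace ℝ (Fin n) → EuclideanSpace ℝ (Fin n))
    (X : Set (EuclideanSpace ℝ (Fin n))) : Prop :=
  ∀ x ∈ X, ∀ y ∈ X, x ≠ y → 0 < inner ℝ (F x - F y) (x - y)

/-- `x` solves the variational inequality `VI(X, F)` (only the values of `F` on `X` matter). -/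
def IsVISolution {n : ℕ} (X : Set (EuclideanSpace ℝ (Fin n)))
    (F : EuclideanSpace ℝ (Fin n) → EuclideanSpace ℝ (Fin n))
    (x : EuclideanSpace ℝ (Fin n)) : Prop :=
  x ∈ X ∧ ∀ y ∈ X, 0 ≤ inner ℝ (y - x) (F x)

/-- `x` solves the tensor variational inequality `TVI(X, 𝒜, q)`. -/
def IsTVISolution {m n : ℕ} [NeZero m] (X : Set (EuclideanSpace ℝ (Fin n)))
    (A : RealTensor m n) (q x : EuclideanSpace ℝ (Fin n)) : Prop :=
  x ∈ X ∧ ∀ y ∈ X, 0 ≤ inner ℝ (y - x) (A.applyPow x + q)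

open scoped RealInnerProductSpace

/-! Uniqueness follows by adding the two inequalities, each tested at the other solution. For
existence with `m ≥ 2`, homogeneity and compactness of the part of `X` on the unit sphere make
`⟪A.applyPow x, x⟫` grow at least quadratically, so it dominates `⟪q, x⟫` far out. Solving on `X`
cut by a large ball then gives a point strictly inside the ball, where the cut does not matter. On
compact sets the Minty inequalities define closed sets with the finite intersection property:
finitely many of them reduce to a matrix problem, settled by separating convex sets, and no fixed
point theorem is needed. -/

/-- A square matrix whose symmetric part is entrywise nonnegative maps some point of the standard
simplex into the nonnegative orthant. -/
theorem exists_mem_stdSimplex_mulVec_nonneg {ι : Type*} [Fintype ι] [Nonempty ι]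
    (M : Matrix ι ι ℝ) (hM : ∀ i j, 0 ≤ M i j + M j i) :
    ∃ w ∈ stdSimplex ℝ ι, ∀ i, 0 ≤ (M.mulVec w) i := by
  classical
  by_contra! hcon
  have hcompact : IsCompact (M.mulVecLin '' stdSimplex ℝ ι) :=
    (isCompact_stdSimplex ℝ ι).image M.mulVecLin.continuous_of_finiteDimensional
  have hconv : Convex ℝ (M.mulVecLin '' stdSimplex ℝ ι) :=
    (convex_stdSimplex ℝ ι).linear_image _
  have hdisj : Disjoint (M.mulVecLin '' stdSimplex ℝ ι) (Set.Ici (0 : ι → ℝ)) := by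
    rw [Set.disjoint_left]
    rintro _ ⟨w, hw, rfl⟩ hw0
    obtain ⟨i, hi⟩ := hcon w hw
    exact absurd (hw0 i) (not_le.2 hi)
  obtain ⟨f, u, v, hfu, huv, hfv⟩ := geometric_hahn_banach_compact_closed hconv hcompact
    (convex_Ici (𝕜 := ℝ) (0 : ι → ℝ)) isClosed_Ici hdisj
  have hv : v < 0 := by simpa using hfv 0 (Set.mem_Ici.2 le_rfl)
  set c : ι → ℝ := fun i => f (Pi.single i 1) with hc
  have hf : ∀ x, f x = ∑ i, x i * c i := fun x => by
    conv_lhs => rw [pi_eq_sum_univ' x]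
    simp [hc, map_sum]
  have hc0 : ∀ i, 0 ≤ c i := by
    intro i
    by_contra! hi
    -- The scaling makes `f` equal to `v` at this point of the orthant, against the strict
    -- separation.
    have h := hfv ((v / c i) • Pi.single i 1) (by
      rw [Set.mem_Ici]
      exact smul_nonneg (div_nonneg_of_nonpos hv.le hi.le)
        (Pi.single_nonneg.2 zero_le_one))
    rw [map_smul, smul_eq_mul, ← show c i = f (Pi.single i 1) from rfl,
      div_mul_cancel₀ _ hi.ne] at h
    exact lt_irrefl _ h
  have hneg : ∀ w ∈ stdSimplex ℝ ι, ∑ i, (M.mulVec w) i * c i < 0 := fun w hw => by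
    rw [← hf]
    exact (hfu _ ⟨w, hw, rfl⟩).trans (huv.trans hv)
  have hsum : 0 < ∑ i, c i := by
    refine (Finset.sum_nonneg fun i _ => hc0 i).lt_of_ne fun h => ?_
    have hz : ∀ i, c i = 0 := fun i =>
      (Finset.sum_eq_zero_iff_of_nonneg fun i _ => hc0 i).1 h.symm i (Finset.mem_univ i)
    have := hneg _ (single_mem_stdSimplex ℝ (Classical.arbitrary ι))
    simp [hz] at this
  -- The normalised functional itself is the test point: its quadratic form only sees the symmetric
  -- part of `M`.
  have hlt := hneg ((∑ i, c i)⁻¹ • c) ⟨fun i => mul_nonneg (inv_nonneg.2 hsum.le) (hc0 i), by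
    simp only [Pi.smul_apply, smul_eq_mul, ← Finset.mul_sum]
    exact inv_mul_cancel₀ hsum.ne'⟩
  have hquad : 0 ≤ ∑ i, (M.mulVec c) i * c i := by
    have h1 : ∑ i, (M.mulVec c) i * c i = ∑ i, ∑ j, M i j * (c i * c j) := by
      simp only [Matrix.mulVec, dotProduct, Finset.sum_mul]
      exact Finset.sum_congr rfl fun i _ => Finset.sum_congr rfl fun j _ => by ring
    have h2 : ∑ i, ∑ j, M i j * (c i * c j) = ∑ i, ∑ j, M j i * (c i * c j) := by
      rw [Finset.sum_comm]
      exact Finset.sum_congr rfl fun i _ => Finset.sum_congr rfl fun j _ => by ring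
    have h3 : 0 ≤ ∑ i, ∑ j, (M i j + M j i) * (c i * c j) :=
      Finset.sum_nonneg fun i _ => Finset.sum_nonneg fun j _ =>
        mul_nonneg (hM i j) (mul_nonneg (hc0 i) (hc0 j))
    simp only [add_mul, Finset.sum_add_distrib] at h3
    linarith
  simp only [Matrix.mulVec_smul, Pi.smul_apply, smul_eq_mul, mul_assoc, ← Finset.mul_sum] at hlt
  exact absurd (mul_nonneg (inv_nonneg.2 hsum.le) hquad) (not_le.2 hlt)

section Monotone

variable {E : Type*} [NormedAddCommGroup E] [InnerProductSpace ℝ E]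

/-- The Minty inequalities of a monotone map at finitely many points of a convex set have a common
solution in the set. -/
theorem exists_forall_finset_minty {K : Set E} (hK : Convex ℝ K) (hne : K.Nonempty) {F : E → E}
    (hF : ∀ x ∈ K, ∀ y ∈ K, 0 ≤ ⟪F x - F y, x - y⟫) (s : Finset K) :
    ∃ x ∈ K, ∀ y ∈ s, 0 ≤ ⟪F y, (y : E) - x⟫ := by
  rcases s.eq_empty_or_nonempty with rfl | hs
  · exact hne.imp fun x hx => ⟨hx, by simp⟩
  have : Nonempty s := hs.to_subtype
  -- Monotonicity is exactly the sign condition on `M i j + M j i`; `w` gives the barycentric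
  -- weights of the common solution.
  obtain ⟨w, ⟨hw0, hw1⟩, hw⟩ := exists_mem_stdSimplex_mulVec_nonneg
    (Matrix.of fun i j : s => ⟪F i, (i : E) - j⟫) (fun i j => by
      have h := hF i i.1.2 j j.1.2
      have : ⟪F i - F j, (i : E) - j⟫ = ⟪F i, (i : E) - j⟫ + ⟪F j, (j : E) - i⟫ := by
        simp only [inner_sub_left, inner_sub_right]
        ring
      simpa [this] using h)
  refine ⟨∑ j, w j • (j : E), hK.sum_mem (fun j _ => hw0 j) hw1 fun j _ => j.1.2,
    fun y hy => ?_⟩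
  have h := hw ⟨y, hy⟩
  have hdecomp : (y : E) - ∑ j, w j • (j : E) = ∑ j, w j • ((y : E) - j) := by
    simp only [smul_sub, Finset.sum_sub_distrib, ← Finset.sum_smul, hw1, one_smul]
  rw [hdecomp, inner_sum]
  simpa [Matrix.mulVec, dotProduct, real_inner_smul_right, mul_comm] using h

/-- A point of a convex set satisfying the Minty inequalities of a continuous map satisfies its
variational inequality. -/
theorem inner_nonneg_of_minty {K : Set E} (hK : Convex ℝ K) {F : E → E} (hF : Continuous F)
    {x : E} (hx : x ∈ K) (hminty : ∀ y ∈ K, 0 ≤ ⟪F y, y - x⟫) {y : E} (hy : y ∈ K) :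
    0 ≤ ⟪F x, y - x⟫ := by
  have hlim : Filter.Tendsto (fun t : ℝ => ⟪F (x + t • (y - x)), y - x⟫)
      (nhdsWithin 0 (Set.Ioi 0)) (nhds ⟪F x, y - x⟫) := by
    have hcont : Continuous fun t : ℝ => ⟪F (x + t • (y - x)), y - x⟫ := by fun_prop
    simpa using (hcont.tendsto 0).mono_left nhdsWithin_le_nhds
  refine ge_of_tendsto hlim ?_
  filter_upwards [Ioo_mem_nhdsGT (zero_lt_one (α := ℝ))] with t ht
  have h := hminty _ (hK.add_smul_sub_mem hx hy ⟨ht.1.le, ht.2.le⟩)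
  rw [add_sub_cancel_left, real_inner_smul_right] at h
  exact nonneg_of_mul_nonneg_right h ht.1

/-- A continuous monotone map on a nonempty compact convex set has a solution of its variational
inequality. -/
theorem IsCompact.exists_variationalInequality {K : Set E} (hK : IsCompact K)
    (hconv : Convex ℝ K) (hne : K.Nonempty) {F : E → E} (hF : Continuous F)
    (hmono : ∀ x ∈ K, ∀ y ∈ K, 0 ≤ ⟪F x - F y, x - y⟫) :
    ∃ x ∈ K, ∀ y ∈ K, 0 ≤ ⟪F x, y - x⟫ := by
  obtain ⟨x, hxK, hx⟩ := hK.inter_iInter_nonempty (fun y : K => {x : E | 0 ≤ ⟪F y, (y : E) - x⟫})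
    (fun y => isClosed_le continuous_const (by fun_prop)) (fun s => by
      obtain ⟨x, hxK, hx⟩ := exists_forall_finset_minty hconv hne hmono s
      exact ⟨x, hxK, by simpa using hx⟩)
  rw [Set.mem_iInter] at hx
  exact ⟨x, hxK, fun y hy => inner_nonneg_of_minty hconv hF hxK (fun z hz => hx ⟨z, hz⟩) hy⟩

/-- A continuous monotone map on a closed convex set containing the origin has a solution of its
variational inequality as soon as `⟪F x, x⟫` is positive far from the origin. -/
theorem IsClosed.exists_variationalInequality [ProperSpace E] {X : Set E} (hX : IsClosed X)
    (hconv : Convex ℝ X) (h0 : 0 ∈ X) {F : E → E} (hF : Continuous F)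
    (hmono : ∀ x ∈ X, ∀ y ∈ X, 0 ≤ ⟪F x - F y, x - y⟫) {R : ℝ} (hR : 0 < R)
    (hpos : ∀ x ∈ X, R ≤ ‖x‖ → 0 < ⟪F x, x⟫) :
    ∃ x ∈ X, ∀ y ∈ X, 0 ≤ ⟪F x, y - x⟫ := by
  obtain ⟨x, ⟨hxX, -⟩, hx⟩ := IsCompact.exists_variationalInequality
    ((isCompact_closedBall (0 : E) R).inter_left hX)
    (hconv.inter (convex_closedBall 0 R)) ⟨0, h0, Metric.mem_closedBall_self hR.le⟩ hF
    (fun x hx y hy => hmono x hx.1 y hy.1)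
  -- Testing at the origin excludes the boundary of the ball.
  have hxR : ‖x‖ < R := by
    by_contra! h
    have h1 := hx 0 ⟨h0, Metric.mem_closedBall_self hR.le⟩
    rw [zero_sub, inner_neg_right] at h1
    linarith [hpos x hxX h]
  refine ⟨x, hxX, fun y hy => ?_⟩
  have hev : ∀ᶠ t : ℝ in nhdsWithin 0 (Set.Ioi 0), ‖x + t • (y - x)‖ < R := by
    have hcont : Continuous fun t : ℝ => ‖x + t • (y - x)‖ := by fun_prop
    exact nhdsWithin_le_nhds ((hcont.tendsto 0).eventually_lt_const (by simpa using hxR))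
  obtain ⟨t, htR, ht⟩ := (hev.and (Ioo_mem_nhdsGT (zero_lt_one (α := ℝ)))).exists
  have h := hx _ ⟨hconv.add_smul_sub_mem hxX hy ⟨ht.1.le, ht.2.le⟩,
    mem_closedBall_zero_iff.2 htR.le⟩
  rw [add_sub_cancel_left, real_inner_smul_right] at h
  exact nonneg_of_mul_nonneg_right h ht.1

end Monotone

namespace RealTensor

variable {m n : ℕ} [NeZero m] (A : RealTensor m n)

theorem continuous_applyPow : Continuous A.applyPow := by
  unfold applyPow
  refine (PiLp.continuous_toLp 2 _).comp (continuous_pi fun i => ?_)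
  fun_prop

theorem applyPow_smul (t : ℝ) (x : EuclideanSpace ℝ (Fin n)) :
    A.applyPow (t • x) = t ^ (m - 1) • A.applyPow x := by
  ext i
  simp only [applyPow, PiLp.smul_apply, smul_eq_mul, Finset.mul_sum, Finset.prod_mul_distrib,
    Finset.prod_const, Finset.card_erase_of_mem (Finset.mem_univ _), Finset.card_univ,
    Fintype.card_fin]
  exact Finset.sum_congr rfl fun j _ => by ring

variable {A}

/-- Strict positive definiteness on a closed convex set containing the origin yields a quadratic
lower bound outside the unit ball. -/
theorem StrictlyPosDefOn.exists_mul_sq_le_inner (hm : 2 ≤ m)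
    {X : Set (EuclideanSpace ℝ (Fin n))} (hX : IsClosed X) (hconv : Convex ℝ X) (h0 : 0 ∈ X)
    (hA : A.StrictlyPosDefOn X) :
    ∃ c > 0, ∀ x ∈ X, 1 ≤ ‖x‖ → c * ‖x‖ ^ 2 ≤ ⟪A.applyPow x, x⟫ := by
  have hzero : A.applyPow 0 = 0 := by
    simpa [show m - 1 ≠ 0 by omega] using A.applyPow_smul 0 0
  have hpos : ∀ x ∈ X, x ≠ 0 → 0 < ⟪A.applyPow x, x⟫ := fun x hx hne => by
    simpa [hzero, real_inner_comm] using hA x hx 0 h0 hne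
  have hbound : ∃ c > 0, ∀ u ∈ X, ‖u‖ = 1 → c ≤ ⟪A.applyPow u, u⟫ := by
    rcases (X ∩ Metric.sphere 0 1).eq_empty_or_nonempty with he | hne
    · exact ⟨1, one_pos, fun u hu h1 => absurd (he.subset ⟨hu, by simpa using h1⟩) (by simp)⟩
    · obtain ⟨d, ⟨hdX, hd⟩, hmin⟩ := ((isCompact_sphere 0 1).inter_left hX).exists_isMinOn hne
        (A.continuous_applyPow.inner (𝕜 := ℝ) continuous_id).continuousOn
      refine ⟨_, hpos d hdX (ne_zero_of_mem_unit_sphere ⟨d, hd⟩), fun u hu h1 => ?_⟩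
      exact hmin ⟨hu, by simpa using h1⟩
  obtain ⟨c, hc, hcX⟩ := hbound
  refine ⟨c, hc, fun x hx h1 => ?_⟩
  have hx0 : 0 < ‖x‖ := one_pos.trans_le h1
  -- Shrinking towards the origin stays in `X`, which is why only `1 ≤ ‖x‖` is treated.
  have hu : ‖x‖⁻¹ • x ∈ X :=
    hconv.smul_mem_of_zero_mem h0 hx ⟨(inv_pos.2 hx0).le, inv_le_one_of_one_le₀ h1⟩
  have hcu := hcX _ hu (norm_smul_inv_norm (𝕜 := ℝ) (norm_pos_iff.1 hx0))
  have hxu : x = ‖x‖ • (‖x‖⁻¹ • x) := (smul_inv_smul₀ hx0.ne' x).symm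
  have hval : ⟪A.applyPow x, x⟫ = ‖x‖ ^ m * ⟪A.applyPow (‖x‖⁻¹ • x), ‖x‖⁻¹ • x⟫ := by
    conv_lhs => rw [hxu]
    rw [applyPow_smul, real_inner_smul_left, real_inner_smul_right, ← mul_assoc, ← pow_succ,
      Nat.sub_add_cancel (by omega)]
  rw [hval, mul_comm c]
  exact mul_le_mul (pow_le_pow_right₀ h1 hm) hcu hc.le (by positivity)

theorem StrictlyPosDefOn.exists_isTVISolution {X : Set (EuclideanSpace ℝ (Fin n))}
    (hX : IsClosed X) (hconv : Convex ℝ X) (h0 : 0 ∈ X) (hA : A.StrictlyPosDefOn X)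
    (q : EuclideanSpace ℝ (Fin n)) : ∃ x, IsTVISolution X A q x := by
  have hm0 : m ≠ 0 := NeZero.ne m
  rcases Nat.lt_or_ge m 2 with hm | hm
  -- Here `m = 1`, and `0 ^ 0 = 1` in the homogeneity identity makes the map constant; strictness
  -- then forces `X = {0}`.
  · have hconst : ∀ x, A.applyPow x = A.applyPow 0 := fun x => by
      simpa [show m - 1 = 0 by omega] using (A.applyPow_smul 0 x).symm
    refine ⟨0, h0, fun y hy => ?_⟩
    have hy0 : y = 0 := by
      by_contra hne
      simpa [hconst y] using hA y hy 0 h0 hne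
    simp [hy0]
  · obtain ⟨c, hc, hcX⟩ := hA.exists_mul_sq_le_inner hm hX hconv h0
    have hmono : ∀ x ∈ X, ∀ y ∈ X,
        0 ≤ ⟪(A.applyPow x + q) - (A.applyPow y + q), x - y⟫ := fun x hx y hy => by
      rw [add_sub_add_right_eq_sub, real_inner_comm]
      rcases eq_or_ne x y with rfl | hne
      · simp
      · exact (hA x hx y hy hne).le
    -- The summand `1` puts `x` where the quadratic bound holds; `‖q‖ / c` makes `c * ‖x‖` exceed
    -- `‖q‖`.
    have hR : 0 < 1 + ‖q‖ / c := by positivity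
    obtain ⟨x, hx, hxy⟩ := IsClosed.exists_variationalInequality hX hconv h0
      (F := fun x => A.applyPow x + q)
      (A.continuous_applyPow.add continuous_const) hmono hR fun x hx hxR => by
        have h1 : 1 ≤ ‖x‖ := le_trans (by linarith [show 0 ≤ ‖q‖ / c by positivity]) hxR
        have hqc : ‖q‖ < c * ‖x‖ := by
          rw [mul_comm, ← div_lt_iff₀ hc]
          linarith
        have hq : -(‖q‖ * ‖x‖) ≤ ⟪q, x⟫ :=
          neg_le_of_abs_le (abs_real_inner_le_norm q x)
        have hlt : ‖q‖ * ‖x‖ < c * ‖x‖ * ‖x‖ := by gcongr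
        rw [inner_add_left]
        linarith [hcX x hx h1, show c * ‖x‖ ^ 2 = c * ‖x‖ * ‖x‖ by ring]
    exact ⟨x, hx, fun y hy => by rw [real_inner_comm]; exact hxy y hy⟩

theorem StrictlyPosDefOn.isTVISolution_unique {X : Set (EuclideanSpace ℝ (Fin n))}
    (hA : A.StrictlyPosDefOn X) {q x y : EuclideanSpace ℝ (Fin n)}
    (hx : IsTVISolution X A q x) (hy : IsTVISolution X A q y) : x = y := by
  by_contra hne
  have h := hA x hx.1 y hy.1 hne
  have h1 := hx.2 y hy.1
  have h2 := hy.2 x hx.1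
  simp only [inner_sub_left, inner_sub_right, inner_add_right] at h h1 h2
  linarith

theorem StrictlyPosDefOn.existsUnique_isTVISolution {X : Set (EuclideanSpace ℝ (Fin n))}
    (hX : IsClosed X) (hconv : Convex ℝ X) (h0 : 0 ∈ X) (hA : A.StrictlyPosDefOn X)
    (q : EuclideanSpace ℝ (Fin n)) : ∃! x, IsTVISolution X A q x :=
  existsUnique_of_exists_of_unique (hA.exists_isTVISolution hX hconv h0 q)
    fun _ _ => hA.isTVISolution_unique

end RealTensor

theorem StrictlyMonotoneOn.strictlyPosDefOn {m n : ℕ} [NeZero m] {A : RealTensor m n}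
    {X : Set (EuclideanSpace ℝ (Fin n))} {p : EuclideanSpace ℝ (Fin n)}
    (h : StrictlyMonotoneOn (fun x => A.applyPow x + p) X) : A.StrictlyPosDefOn X :=
  fun x hx y hy hne => by
    simpa only [add_sub_add_right_eq_sub, real_inner_comm] using h x hx y hy hne

theorem theorem4p3 {m n : ℕ} [NeZero m] (X : Set (EuclideanSpace ℝ (Fin n)))
    (hXclosed : IsClosed X) (hXconvex : Convex ℝ X) (hX0 : 0 ∈ X) (A : RealTensor m n) :
    (A.StrictlyPosDefOn X → ∀ q : EuclideanSpace ℝ (Fin n), ∃! x, IsTVISolution X A q x) ∧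
    (∀ p : EuclideanSpace ℝ (Fin n), StrictlyMonotoneOn (fun x => A.applyPow x + p) X →
      ∀ q : EuclideanSpace ℝ (Fin n), ∃! x, IsVISolution X (fun x => A.applyPow x + q) x) :=
  ⟨fun hA => hA.existsUnique_isTVISolution hXclosed hXconvex hX0,
    fun _ hF => hF.strictlyPosDefOn.existsUnique_isTVISolution hXclosed hXconvex hX0⟩
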